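/- Let $p$ be a prime and let $C\subseteq\mathbb F_p^{m+1}$ be a linear code with coordinates $0,1,\dots,m$ and dimension $n$. Suppose that $C$ is MDS, i.e. its minimum distance equals $(m+1)-n+1$. The Massey secret-sharing scheme over $C$ shares a secret $s\in\mathbb F_p$ among $m$ parties by choosing a uniformly random codeword $c\in C$ with $c_0=s$ and giving $c_i$ to party $i$, for $1\le i\le m$. The rate of the scheme is $n/m$. Given one-bit leakage functions $f_i:\mathbb F_p\to\{\pm1\}$ $(1\le i\le m)$, the leakage transcript of $s$ is the random variable $L(s)=(f_1(c_1),\dots,f_m(c_m))\in\{\pm1\}^m$. Proposition 1.8. Over prime fields of odd order, the Massey scheme of any MDS code of rate at least $0.7496$ is one-bit local-leakage resilient. That is, there are absolute constants $c>0$ and $m_0$ such that for all $m\ge m_0$, all odd primes $p$, all MDS codes $C\subseteq\mathbb F_p^{m+1}$ of dimension $n$ with $n/m\ge 0.7496$, all leakage functions $f_1,\dots,f_m:\mathbb F_p\to\{\pm1\}$, and all distinct secrets $s\neq s'$ in $\mathbb F_p$, $$d_{\mathrm{TV}}\bigl(L(s),L(s')\bigr)=\frac12\sum_{\ell\in\{\pm1\}^m}\bigl|\Pr[L(s)=\ell]-\Pr[L(s')=\ell]\bigr|\le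 2^{-cm}.$$ -/

import Mathlib

namespace LeakageResilience

/-- The minimum distance of a linear code: the least Hamming weight of a non-zero codeword. -/
noncomputable def minDist {F : Type*} [Field F] [DecidableEq F] {N : ℕ}
    (C : Submodule F (Fin N → F)) : ℕ :=
  sInf {w : ℕ | ∃ c ∈ C, c ≠ 0 ∧ hammingNorm c = w}

/-- A linear code of length `N` and dimension `n` is maximum distance separable if its minimum
distance `d` meets the Singleton bound, `d = N - n + 1`. The zero code is not MDS here. -/
def IsMDS {F : Type*} [Field F] [DecidableEq F] {N : ℕ} (C : Submodule F (Fin N → F)) : Prop :=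
  minDist C + Module.finrank F C = N + 1

/-- The possible outcomes of sharing the secret `s` among `m` parties with Massey's scheme
over the code `C` of length `m + 1`: all codewords `c` with `c 0 = s`. The dealer picks one of
them uniformly at random, and party `i : Fin m` receives the share `c i.succ`. -/
def sharings {F : Type*} [Field F] {m : ℕ} (C : Submodule F (Fin (m + 1) → F)) (s : F) :
    Set (Fin (m + 1) → F) :=
  {c | c ∈ C ∧ c 0 = s}

/-- The leakage transcript: party `i` leaks the bit `f i (c i.succ)`, an element of `{1, -1}`,
which is a function of its own share only. -/
def transcript {F : Type*} {m : ℕ} (f : Fin m → F → ℤˣ) (c : Fin (m + 1) → F) : Fin m → ℤˣ :=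
  fun i => f i (c i.succ)

/-- The probability that the leakage transcript equals `l` when the secret `s` is shared. -/
noncomputable def transcriptProb {F : Type*} [Field F] {m : ℕ}
    (C : Submodule F (Fin (m + 1) → F)) (f : Fin m → F → ℤˣ) (s : F) (l : Fin m → ℤˣ) : ℝ :=
  ({c ∈ sharings C s | transcript f c = l}.ncard : ℝ) / ((sharings C s).ncard : ℝ)

/-- The total variation distance of two distributions on a finite set, given by their
probability mass functions. -/
noncomputable def tvDist {α : Type*} [Fintype α] (P Q : α → ℝ) : ℝ :=
  (1 / 2) * ∑ a, |P a - Q a|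

/-- Massey's scheme over `C` is one-bit local-leakage resilient with error `ε`: for all one-bit
local leakage functions, the transcripts of any two distinct secrets are `ε`-close in total
variation distance. -/
def OneBitLeakageResilient {F : Type*} [Field F] {m : ℕ} (C : Submodule F (Fin (m + 1) → F))
    (ε : ℝ) : Prop :=
  ∀ (f : Fin m → F → ℤˣ) (s s' : F), s ≠ s' →
    tvDist (transcriptProb C f s) (transcriptProb C f s') ≤ ε

end LeakageResilience

/-!
Let `n` be the dimension of the code. Party `i` leaks a sign `f i`; write `β i` for its mean and
`g i` for its standardisation `(f i - β i) / √(1 - β i ^ 2)` (zero if `f i` is constant).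

*Reduction to correlations.* The probability of a transcript is a multilinear polynomial in the
`g i`. By Cauchy-Schwarz with respect to the product measure on `{1, -1} ^ m` with means `β i`, the
squared distance of two transcripts is at most `1 / 4` of the sum over all sets `S` of parties of
`(E_s[∏ i ∈ S, g i] - E_s'[∏ i ∈ S, g i]) ^ 2` (`sum_abs_sum_le_sqrt`, `transcriptProb_eq_sum`).
The weighted measure, rather than the uniform one, is what makes biased leakage harmless: the
`g i` have no Fourier coefficient at zero.

*Correlations of MDS shares.* By Poisson summation, `|E_s[∏ i ∈ S, g i]|` is at most the sum
of the products of the absolute Fourier coefficients of the `g i` over the vectors `a` supported in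
`S` and orthogonal to the shares of zero. Such a vector is determined by any `#S - n + 1`
coordinates in `S`. Choosing two disjoint sets of that many coordinates, the arithmetic-geometric
mean inequality and Parseval's identity bound their contribution by one, and the remaining
`2 * n - 2 - #S` coordinates contribute at most `√τ` each, where `τ` bounds the squared Fourier
coefficients. If `1 ≤ #S < n`, the correlation vanishes (`IsMDS.abs_shareMean_prod_le`). Summing
over `S` gives the bound `τ⁻¹ ^ 2 * (τ / 3) ^ n * 4 ^ m` (`IsMDS.tvDist_sq_le`).

*The size of the Fourier coefficients.* At rate `0.7496` this decays exponentially if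
`τ = 0.47` (`pow_mul_four_pow_le`). The trivial bound, from the symmetry `a ↦ -a`, is `τ = 1 / 2`.
For `p ≥ 5` it improves to `0.47` (`norm_fourierCoeff_sq_le`): if nearly all of the variance of `f`
sits at `±a`, then the convolution identity `∑ b, F b * F (2 * a - b) = 0`, which expresses
`f ^ 2 = 1`, cannot hold, unless the bias is large, and then the coefficient is small
for trivial reasons. For `p = 3` the bound `τ = 1 / 2` suffices, as an MDS code over three elements
of dimension at least two has codimension at most two (`IsMDS.length_succ_le`).
-/

namespace LeakageResilience

/-! ### MDS codes -/

section MDS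

theorem finrank_le_length {F : Type*} [Field F] {N : ℕ} (C : Submodule F (Fin N → F)) :
    Module.finrank F C ≤ N := by
  simpa using Submodule.finrank_le C

variable {F : Type*} [Field F] [DecidableEq F] {N : ℕ} {C : Submodule F (Fin N → F)}

theorem IsMDS.eq_zero_of_forall_eq_zero (hC : IsMDS C) {c : Fin N → F} (hc : c ∈ C)
    {T : Finset (Fin N)} (hT : Module.finrank F C ≤ T.card) (h0 : ∀ t ∈ T, c t = 0) : c = 0 := by
  by_contra hne
  have h1 : minDist C ≤ hammingNorm c := Nat.sInf_le ⟨c, hc, hne, rfl⟩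
  have h2 : hammingNorm c ≤ Tᶜ.card := by
    refine Finset.card_le_card fun i hi => ?_
    rw [Finset.mem_compl]
    intro hiT
    exact (Finset.mem_filter.1 hi).2 (h0 i hiT)
  have h3 : Tᶜ.card + T.card = N := by simp
  have h4 : minDist C + Module.finrank F C = N + 1 := hC
  omega

/-- Any `finrank F C` coordinates of an MDS code form an information set. -/
theorem IsMDS.exists_mem_eqOn (hC : IsMDS C) {T : Finset (Fin N)}
    (hT : T.card ≤ Module.finrank F C) (v : Fin N → F) : ∃ c ∈ C, ∀ t ∈ T, c t = v t := by
  obtain ⟨U, hTU, hU⟩ := Finset.exists_superset_card_eq hT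
    (by simpa using finrank_le_length C)
  let φ : C →ₗ[F] (U → F) := (LinearMap.funLeft F F (Subtype.val : U → Fin N)).comp C.subtype
  have hinj : Function.Injective φ := by
    rw [← LinearMap.ker_eq_bot, LinearMap.ker_eq_bot']
    rintro ⟨c, hc⟩ h
    have : c = 0 := hC.eq_zero_of_forall_eq_zero hc (T := U) hU.ge fun t ht => by
      exact congrFun h ⟨t, ht⟩
    exact Subtype.ext this
  have hsurj : Function.Surjective φ :=
    (LinearMap.injective_iff_surjective_of_finrank_eq_finrank (by simp [hU])).1 hinj
  obtain ⟨⟨c, hc⟩, h⟩ := hsurj fun u => v u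
  exact ⟨c, hc, fun t ht => by exact congrFun h ⟨t, hTU ht⟩⟩

/-- The classical bound on the length of an MDS code of dimension at least two: the codewords
vanishing on `n - 2` given coordinates, and equal to one on a further one, form a line on which
the remaining coordinates vanish at pairwise distinct points. -/
theorem IsMDS.length_succ_le [Fintype F] (hC : IsMDS C) (hn : 2 ≤ Module.finrank F C) :
    N + 1 ≤ Module.finrank F C + Fintype.card F := by
  set n := Module.finrank F C with hn_def
  have hnN : n ≤ N := finrank_le_length C
  obtain ⟨U, -, hU⟩ := Finset.exists_superset_card_eq (s := (∅ : Finset (Fin N))) (n := n)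
    (by simp) (by simpa using hnN)
  obtain ⟨i, hi, j, hj, hij⟩ := Finset.one_lt_card.1 (by omega : 1 < U.card)
  set T := (U.erase i).erase j with hT_def
  have hTj : T.card = n - 2 := by
    rw [hT_def, Finset.card_erase_of_mem (Finset.mem_erase.2 ⟨hij.symm, hj⟩),
      Finset.card_erase_of_mem hi, hU]
    omega
  have hword : ∀ x : F, ∃ c ∈ C, (∀ t ∈ T, c t = 0) ∧ c i = 1 ∧ c j = x := by
    intro x
    obtain ⟨c, hc, h⟩ := hC.exists_mem_eqOn (T := U) hU.le
      (fun t => if t = i then 1 else if t = j then x else 0)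
    refine ⟨c, hc, fun t ht => ?_, by simpa using h i hi, by simpa [hij.symm] using h j hj⟩
    simp only [hT_def, Finset.mem_erase] at ht
    simpa [ht.1, ht.2.1] using h t ht.2.2
  choose w hwC hwT hwi hwj using hword
  have hiT : i ∉ T := by simp [hT_def]
  have hjT : j ∉ T := by simp [hT_def]
  have hTU : T ⊆ U := (Finset.erase_subset _ _).trans (Finset.erase_subset _ _)
  -- A codeword vanishing on `T` and on two further coordinates is zero.
  have hzero : ∀ c ∈ C, ∀ a b : Fin N, a ∉ T → b ∉ T → a ≠ b → (∀ t ∈ T, c t = 0) →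
      c a = 0 → c b = 0 → c = 0 := by
    intro c hc a b ha hb hab hcT hca hcb
    refine hC.eq_zero_of_forall_eq_zero hc (T := insert a (insert b T)) ?_ ?_
    · rw [Finset.card_insert_of_notMem (by simp [hab, ha]), Finset.card_insert_of_notMem hb, hTj]
      omega
    · intro t ht
      simp only [Finset.mem_insert] at ht
      rcases ht with rfl | rfl | ht
      exacts [hca, hcb, hcT t ht]
  have hroot : ∀ u : Fin N, u ∉ U → ∃ x, w x u = 0 := by
    intro u hu
    have hinj : Function.Injective fun x => w x u := by
      intro x y hxy
      have := hzero (w x - w y) (C.sub_mem (hwC x) (hwC y)) u i (fun h => hu (hTU h)) hiT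
        (fun h => hu (h ▸ hi)) (fun t ht => by simp [hwT _ t ht])
        (by simpa [sub_eq_zero] using hxy) (by simp [hwi])
      have h2 := congrFun this j
      simpa [hwj, sub_eq_zero] using h2
    exact (Finite.injective_iff_surjective.1 hinj) 0
  choose! r hr using hroot
  have hcard : Uᶜ.card ≤ (Finset.univ.erase (0 : F)).card := by
    refine Finset.card_le_card_of_injOn r ?_ ?_
    · intro u hu
      have huU : u ∉ U := by simpa using hu
      simp only [Finset.coe_erase, Finset.coe_univ, Set.mem_sdiff, Set.mem_univ,
        Set.mem_singleton_iff, true_and]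
      intro h0
      have := hzero (w (r u)) (hwC _) u j (fun h => huU (hTU h)) hjT (fun h => huU (h ▸ hj))
        (hwT _) (hr u huU) (by rw [hwj, h0])
      simpa [this] using hwi (r u)
    · intro u hu v hv huv
      have huU : u ∉ U := by simpa using hu
      have hvU : v ∉ U := by simpa using hv
      by_contra hne
      have := hzero (w (r u)) (hwC _) u v (fun h => huU (hTU h)) (fun h => hvU (hTU h)) hne
        (hwT _) (hr u huU) (by rw [huv]; exact hr v hvU)
      simpa [this] using hwi (r u)
  rw [Finset.card_compl, hU, Finset.card_erase_of_mem (Finset.mem_univ _), Finset.card_univ,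
    Fintype.card_fin] at hcard
  have : 0 < Fintype.card F := Fintype.card_pos
  omega

/-- The dual distance of the code of shares of the secret zero: a vector of weight less than
the dimension `n` which is orthogonal to all of these shares is zero. -/
theorem IsMDS.eq_zero_of_orthogonal {m : ℕ} {C : Submodule F (Fin (m + 1) → F)} (hC : IsMDS C)
    {a : Fin m → F} (ha : ∀ z ∈ C, z 0 = 0 → ∑ i, a i * z i.succ = 0)
    {T : Finset (Fin m)} (hT : T.card < Module.finrank F C) (hsupp : ∀ i ∉ T, a i = 0) :
    a = 0 := by
  ext j
  by_contra hj
  simp only [Pi.zero_apply] at hj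
  have hjT : j ∈ T := by
    by_contra h
    exact hj (hsupp j h)
  obtain ⟨c, hc, h⟩ := hC.exists_mem_eqOn (T := insert 0 (T.image Fin.succ))
    ((Finset.card_insert_le _ _).trans (by
      have := Finset.card_image_le (s := T) (f := Fin.succ)
      omega)) (fun t => if t = j.succ then 1 else 0)
  have h0 : c 0 = 0 := by
    rw [h 0 (by simp), if_neg (Fin.succ_ne_zero j).symm]
  have := ha c hc h0
  rw [Finset.sum_eq_single j] at this
  · rw [h j.succ (by simp [hjT])] at this
    simp at this
    exact hj this
  · intro i _ hij
    by_cases hi : i ∈ T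
    · rw [h i.succ (by simp [hi])]
      simp [hij]
    · simp [hsupp i hi]
  · simp

end MDS

/-! ### Fourier analysis on `ZMod p` -/

section Fourier

open ZMod ComplexConjugate

variable {p : ℕ} [Fact p.Prime]

/-- The Fourier coefficients of a function on `ZMod p`, normalised so that
`g x = ∑ a, fourierCoeff g a * stdAddChar (a * x)`. -/
noncomputable def fourierCoeff (g : ZMod p → ℂ) (a : ZMod p) : ℂ :=
  (p : ℂ)⁻¹ * ∑ x, g x * stdAddChar (-(a * x))

theorem prime_cast_ne_zero : (p : ℂ) ≠ 0 :=
  Nat.cast_ne_zero.2 (Fact.out : p.Prime).ne_zero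

theorem sum_fourierCoeff_mul (g : ZMod p → ℂ) (x : ZMod p) :
    ∑ a, fourierCoeff g a * stdAddChar (a * x) = g x := by
  have hprim := isPrimitive_stdAddChar p
  calc ∑ a, fourierCoeff g a * stdAddChar (a * x)
      = ∑ a, ∑ y, (p : ℂ)⁻¹ * g y * stdAddChar (a * (x - y)) := by
        refine Finset.sum_congr rfl fun a _ => ?_
        rw [fourierCoeff, Finset.mul_sum, Finset.sum_mul]
        refine Finset.sum_congr rfl fun y _ => ?_
        rw [show a * (x - y) = -(a * y) + a * x by ring, AddChar.map_add_eq_mul]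
        ring
    _ = ∑ y, (p : ℂ)⁻¹ * g y * ∑ a, stdAddChar (a * (x - y)) := by
        rw [Finset.sum_comm]
        simp_rw [Finset.mul_sum]
    _ = g x := by
        simp_rw [AddChar.sum_mulShift _ hprim, sub_eq_zero]
        rw [Finset.sum_eq_single x]
        · have := prime_cast_ne_zero (p := p)
          rw [if_pos rfl, ZMod.card]
          field_simp
        · intro y _ hy
          simp [hy.symm]
        · simp

/-- The Fourier coefficients of a product are the convolution of the Fourier coefficients. -/
theorem fourierCoeff_mul (g h : ZMod p → ℂ) (a : ZMod p) :
    fourierCoeff (fun x => g x * h x) a = ∑ b, fourierCoeff g b * fourierCoeff h (a - b) := by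
  calc fourierCoeff (fun x => g x * h x) a
      = ∑ x, ∑ b, fourierCoeff g b * ((p : ℂ)⁻¹ * (h x * stdAddChar (-((a - b) * x)))) := by
        rw [fourierCoeff, Finset.mul_sum]
        refine Finset.sum_congr rfl fun x _ => ?_
        nth_rewrite 1 [← sum_fourierCoeff_mul g x]
        rw [Finset.sum_mul, Finset.sum_mul, Finset.mul_sum]
        refine Finset.sum_congr rfl fun b _ => ?_
        rw [show -((a - b) * x) = b * x + -(a * x) by ring, AddChar.map_add_eq_mul]
        ring
    _ = _ := by
        rw [Finset.sum_comm]
        refine Finset.sum_congr rfl fun b _ => ?_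
        rw [← Finset.mul_sum, ← Finset.mul_sum, fourierCoeff.eq_def h]

theorem norm_stdAddChar (x : ZMod p) : ‖(stdAddChar x : ℂ)‖ = 1 :=
  AddChar.norm_apply _ _

theorem conj_stdAddChar (x : ZMod p) : conj (stdAddChar x : ℂ) = stdAddChar (-x) := by
  rw [AddChar.map_neg_eq_conj]

theorem conj_fourierCoeff (g : ZMod p → ℂ) (a : ZMod p) :
    conj (fourierCoeff g a) = fourierCoeff (fun x => conj (g x)) (-a) := by
  simp only [fourierCoeff, map_mul, map_inv₀, map_natCast, map_sum, conj_stdAddChar, neg_mul]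

theorem norm_fourierCoeff_neg (g : ZMod p → ℝ) (a : ZMod p) :
    ‖fourierCoeff (fun x => (g x : ℂ)) (-a)‖ = ‖fourierCoeff (fun x => (g x : ℂ)) a‖ := by
  have := conj_fourierCoeff (fun x => (g x : ℂ)) a
  simp only [Complex.conj_ofReal] at this
  rw [← this, RCLike.norm_conj]

theorem sum_norm_fourierCoeff_sq (g : ZMod p → ℂ) :
    ∑ a, ‖fourierCoeff g a‖ ^ 2 = (p : ℝ)⁻¹ * ∑ x, ‖g x‖ ^ 2 := by
  have h := fourierCoeff_mul g (fun x => conj (g x)) 0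
  have h1 : ∀ b, fourierCoeff g b * fourierCoeff (fun x => conj (g x)) (0 - b)
      = ((‖fourierCoeff g b‖ ^ 2 : ℝ) : ℂ) := by
    intro b
    rw [zero_sub, ← conj_fourierCoeff, Complex.mul_conj, Complex.normSq_eq_norm_sq]
  rw [Finset.sum_congr rfl fun b _ => h1 b] at h
  simp only [fourierCoeff.eq_def _ 0, zero_mul, neg_zero, AddChar.map_zero_eq_one, mul_one,
    Complex.mul_conj, Complex.normSq_eq_norm_sq] at h
  apply Complex.ofReal_injective
  push_cast at h ⊢
  exact h.symm

theorem fourierCoeff_zero (g : ZMod p → ℂ) : fourierCoeff g 0 = (p : ℂ)⁻¹ * ∑ x, g x := by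
  simp [fourierCoeff]

theorem fourierCoeff_const (c : ℂ) {a : ZMod p} (ha : a ≠ 0) :
    fourierCoeff (fun _ => c) a = 0 := by
  have := AddChar.sum_mulShift (-a) (isPrimitive_stdAddChar p)
  simp only [neg_eq_zero, ha, if_false, mul_neg] at this
  simp only [fourierCoeff, ← Finset.mul_sum, mul_comm a]
  simp [this]

theorem fourierCoeff_add (g h : ZMod p → ℂ) (a : ZMod p) :
    fourierCoeff (fun x => g x + h x) a = fourierCoeff g a + fourierCoeff h a := by
  simp only [fourierCoeff, add_mul, Finset.sum_add_distrib, mul_add]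

theorem fourierCoeff_const_mul (c : ℂ) (g : ZMod p → ℂ) (a : ZMod p) :
    fourierCoeff (fun x => c * g x) a = c * fourierCoeff g a := by
  simp only [fourierCoeff, mul_assoc, ← Finset.mul_sum]
  ring

theorem norm_fourierCoeff_le (g : ZMod p → ℂ) (a : ZMod p) :
    ‖fourierCoeff g a‖ ≤ (p : ℝ)⁻¹ * ∑ x, ‖g x‖ := by
  rw [fourierCoeff, norm_mul, norm_inv, Complex.norm_natCast]
  gcongr
  refine (norm_sum_le _ _).trans (Finset.sum_le_sum fun x _ => ?_)
  rw [norm_mul, norm_stdAddChar, mul_one]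

end Fourier

/-! ### Fourier coefficients of sign functions -/

section SignFunction

open ZMod

variable {p : ℕ} [Fact p.Prime] {f : ZMod p → ℝ}

/-- The average of a real function on `ZMod p`. -/
noncomputable def mean (f : ZMod p → ℝ) : ℝ := (p : ℝ)⁻¹ * ∑ x, f x

theorem prime_cast_pos : (0 : ℝ) < p := Nat.cast_pos.2 (Fact.out : p.Prime).pos

theorem mean_const (c : ℝ) : mean (fun _ : ZMod p => c) = c := by
  have := (prime_cast_pos (p := p)).ne'
  simp [mean, ZMod.card]
  field_simp

theorem mean_mono {f g : ZMod p → ℝ} (h : ∀ x, f x ≤ g x) : mean f ≤ mean g := by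
  have := prime_cast_pos (p := p)
  exact mul_le_mul_of_nonneg_left (Finset.sum_le_sum fun x _ => h x) (by positivity)

theorem fourierCoeff_zero_ofReal (f : ZMod p → ℝ) :
    fourierCoeff (fun x => (f x : ℂ)) 0 = (mean f : ℂ) := by
  simp [fourierCoeff_zero, mean]

theorem two_ne_zero_of_prime_ne_two (hp : p ≠ 2) : (2 : ZMod p) ≠ 0 := by
  intro h
  have : ((2 : ℕ) : ZMod p) = 0 := by exact_mod_cast h
  rw [ZMod.natCast_eq_zero_iff] at this
  exact hp ((Nat.prime_dvd_prime_iff_eq Fact.out Nat.prime_two).1 this)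

theorem three_ne_zero_of_prime_ne_three (hp : p ≠ 3) : (3 : ZMod p) ≠ 0 := by
  intro h
  have : ((3 : ℕ) : ZMod p) = 0 := by exact_mod_cast h
  rw [ZMod.natCast_eq_zero_iff] at this
  exact hp ((Nat.prime_dvd_prime_iff_eq Fact.out Nat.prime_three).1 this)

theorem sum_norm_fourierCoeff_sq_of_sign (hf : ∀ x, f x ^ 2 = 1) :
    ∑ a, ‖fourierCoeff (fun x => (f x : ℂ)) a‖ ^ 2 = 1 := by
  have := (prime_cast_pos (p := p)).ne'
  rw [sum_norm_fourierCoeff_sq]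
  simp [hf, ZMod.card, this]

/-- Since the Fourier coefficients of a real function at `a` and `-a` have the same size, each
of them carries at most half of the variance. -/
theorem two_mul_norm_fourierCoeff_sq_le (hp : p ≠ 2) (hf : ∀ x, f x ^ 2 = 1) {a : ZMod p}
    (ha : a ≠ 0) : 2 * ‖fourierCoeff (fun x => (f x : ℂ)) a‖ ^ 2 ≤ 1 - mean f ^ 2 := by
  have h2a : 2 * a ≠ 0 := mul_ne_zero (two_ne_zero_of_prime_ne_two hp) ha
  have h := Finset.sum_le_univ_sum_of_nonneg (s := {0, a, -a})
    (f := fun a => ‖fourierCoeff (fun x => (f x : ℂ)) a‖ ^ 2) (fun _ => by positivity)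
  rw [sum_norm_fourierCoeff_sq_of_sign hf,
    Finset.sum_insert (by simp [ha, ha.symm]),
    Finset.sum_insert (by
      simp only [Finset.mem_singleton]
      exact fun h => h2a (by linear_combination h)),
    Finset.sum_singleton, norm_fourierCoeff_neg, fourierCoeff_zero_ofReal,
    Complex.norm_real, Real.norm_eq_abs, sq_abs] at h
  linarith

theorem norm_fourierCoeff_sq_add_sq_le (hp : p ≠ 2) (hf : ∀ x, f x ^ 2 = 1) {a b : ZMod p}
    (ha : a ≠ 0) (hb : b ≠ 0) (hab : a ≠ b) (hab' : a ≠ -b) :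
    2 * ‖fourierCoeff (fun x => (f x : ℂ)) a‖ ^ 2 +
      2 * ‖fourierCoeff (fun x => (f x : ℂ)) b‖ ^ 2 ≤ 1 - mean f ^ 2 := by
  have h2a : 2 * a ≠ 0 := mul_ne_zero (two_ne_zero_of_prime_ne_two hp) ha
  have h2b : 2 * b ≠ 0 := mul_ne_zero (two_ne_zero_of_prime_ne_two hp) hb
  have h := Finset.sum_le_univ_sum_of_nonneg (s := {0, a, -a, b, -b})
    (f := fun a => ‖fourierCoeff (fun x => (f x : ℂ)) a‖ ^ 2) (fun _ => by positivity)
  rw [sum_norm_fourierCoeff_sq_of_sign hf,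
    Finset.sum_insert (by simp [ha, hb, ha.symm, hb.symm]),
    Finset.sum_insert (by
      simp only [Finset.mem_insert, Finset.mem_singleton, not_or]
      exact ⟨fun h => h2a (by linear_combination h), hab, hab'⟩),
    Finset.sum_insert (by
      simp only [Finset.mem_insert, Finset.mem_singleton, not_or]
      exact ⟨fun h => hab' (by linear_combination -h), fun h => hab (by linear_combination -h)⟩),
    Finset.sum_insert (by
      simp only [Finset.mem_singleton]
      exact fun h => h2b (by linear_combination h)),
    Finset.sum_singleton, norm_fourierCoeff_neg, norm_fourierCoeff_neg, fourierCoeff_zero_ofReal,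
    Complex.norm_real, Real.norm_eq_abs, sq_abs] at h
  linarith

theorem abs_mean_le_one (hf : ∀ x, f x ^ 2 = 1) : |mean f| ≤ 1 := by
  have h : ∀ x, |f x| ≤ 1 := fun x => (sq_le_one_iff_abs_le_one _).1 (hf x).le
  rw [abs_le]
  constructor
  · simpa [mean_const] using mean_mono (f := fun _ => (-1 : ℝ)) fun x => (abs_le.1 (h x)).1
  · simpa [mean_const] using mean_mono (g := fun _ => (1 : ℝ)) fun x => (abs_le.1 (h x)).2

/-- The trivial bound: up to sign, `f` is twice the indicator of a set of density
`(1 - |mean f|) / 2`, up to an additive constant. -/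
theorem norm_fourierCoeff_le_one_sub_abs_mean (hf : ∀ x, f x ^ 2 = 1) {a : ZMod p}
    (ha : a ≠ 0) : ‖fourierCoeff (fun x => (f x : ℂ)) a‖ ≤ 1 - |mean f| := by
  have h : ∀ x, |f x| ≤ 1 := fun x => (sq_le_one_iff_abs_le_one _).1 (hf x).le
  have hshift : ∀ c : ℝ, ‖fourierCoeff (fun x => (f x : ℂ)) a‖ ≤ mean fun x => |f x + c| := by
    intro c
    have h1 := norm_fourierCoeff_le (fun x => (f x : ℂ) + (c : ℂ)) a
    rw [fourierCoeff_add, fourierCoeff_const _ ha, add_zero] at h1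
    refine h1.trans_eq ?_
    rw [mean]
    congr 1
    refine Finset.sum_congr rfl fun x _ => ?_
    rw [← Complex.ofReal_add, Complex.norm_real, Real.norm_eq_abs]
  have hp := (prime_cast_pos (p := p)).ne'
  have h1 : ‖fourierCoeff (fun x => (f x : ℂ)) a‖ ≤ 1 + mean f := by
    refine (hshift 1).trans_eq ?_
    simp only [mean]
    rw [Finset.sum_congr rfl fun x _ => abs_of_nonneg (by linarith [(abs_le.1 (h x)).1] :
      0 ≤ f x + 1), Finset.sum_add_distrib]
    simp [ZMod.card]
    field_simp
    ring
  have h2 : ‖fourierCoeff (fun x => (f x : ℂ)) a‖ ≤ 1 - mean f := by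
    refine (hshift (-1)).trans_eq ?_
    simp only [mean]
    rw [Finset.sum_congr rfl fun x _ => abs_of_nonpos (by linarith [(abs_le.1 (h x)).2] :
      f x + -1 ≤ 0), Finset.sum_neg_distrib, Finset.sum_add_distrib]
    simp [ZMod.card]
    field_simp
    ring
  rcases abs_cases (mean f) with h | h <;> linarith

/-- The convolution identity `∑ b, F b * F (2 * a - b) = 0`, which holds because `f ^ 2 = 1`, with
the terms `b ∈ {0, 2a, a, -a, 3a}` isolated: the other terms are at most the variance left by
these five frequencies. -/
theorem norm_fourierCoeff_sq_le_of_convolution (hp2 : p ≠ 2) (hp3 : p ≠ 3)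
    (hf : ∀ x, f x ^ 2 = 1) {a : ZMod p} (ha : a ≠ 0) :
    ‖fourierCoeff (fun x => (f x : ℂ)) a‖ ^ 2 ≤
      2 * |mean f| * ‖fourierCoeff (fun x => (f x : ℂ)) (2 * a)‖ +
      2 * ‖fourierCoeff (fun x => (f x : ℂ)) a‖ * ‖fourierCoeff (fun x => (f x : ℂ)) (3 * a)‖ +
      (1 - mean f ^ 2 - 2 * ‖fourierCoeff (fun x => (f x : ℂ)) a‖ ^ 2) := by
  have h2 := two_ne_zero_of_prime_ne_two hp2
  have h2a : 2 * a ≠ 0 := mul_ne_zero h2 ha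
  have h3a : 3 * a ≠ 0 := mul_ne_zero (three_ne_zero_of_prime_ne_three hp3) ha
  have h4a : 2 * (2 * a) ≠ 0 := mul_ne_zero h2 h2a
  set F := fourierCoeff (fun x => (f x : ℂ)) with hF
  have hconv : ∑ b, F b * F (2 * a - b) = 0 := by
    rw [hF, ← fourierCoeff_mul]
    have : (fun x => (f x : ℂ) * (f x : ℂ)) = fun _ => (1 : ℂ) := by
      funext x
      rw [← Complex.ofReal_mul, ← sq, hf, Complex.ofReal_one]
    rw [this, fourierCoeff_const _ h2a]
  set U : Finset (ZMod p) := {0, 2 * a, a, -a, 3 * a} with hU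
  have hsumU : ∀ {M : Type} [AddCommMonoid M] (φ : ZMod p → M),
      ∑ b ∈ U, φ b = φ 0 + (φ (2 * a) + (φ a + (φ (-a) + φ (3 * a)))) := by
    intro M _ φ
    rw [hU, Finset.sum_insert, Finset.sum_insert, Finset.sum_insert, Finset.sum_insert,
      Finset.sum_singleton]
    all_goals simp only [Finset.mem_insert, Finset.mem_singleton, not_or]
    · exact fun h => h4a (by linear_combination -h)
    · exact ⟨fun h => h2a (by linear_combination h), fun h => h2a (by linear_combination -h)⟩
    · exact ⟨fun h => ha (by linear_combination h), fun h => h3a (by linear_combination h),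
        fun h => ha (by linear_combination -h)⟩
    · exact ⟨h2a.symm, ha.symm, (neg_ne_zero.2 ha).symm, h3a.symm⟩
  have hneg : ‖F (-a)‖ = ‖F a‖ := norm_fourierCoeff_neg f a
  have hF0 : ‖F 0‖ = |mean f| := by
    rw [hF, fourierCoeff_zero_ofReal, Complex.norm_real, Real.norm_eq_abs]
  have hmem : ∀ b ∈ Uᶜ, 2 * a - b ∈ Uᶜ := by
    intro b hb
    simp only [hU, Finset.mem_compl, Finset.mem_insert, Finset.mem_singleton, not_or] at hb ⊢
    obtain ⟨h0, h1, h2, h3, h4⟩ := hb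
    exact ⟨fun h => h1 (by linear_combination -h), fun h => h0 (by linear_combination -h),
      fun h => h2 (by linear_combination -h), fun h => h4 (by linear_combination -h),
      fun h => h3 (by linear_combination -h)⟩
  have hinv : ∑ b ∈ Uᶜ, ‖F (2 * a - b)‖ ^ 2 = ∑ b ∈ Uᶜ, ‖F b‖ ^ 2 :=
    Finset.sum_nbij' (fun b => 2 * a - b) (fun b => 2 * a - b) hmem hmem
      (fun b _ => sub_sub_cancel _ _) (fun b _ => sub_sub_cancel _ _) (fun b _ => rfl)
  have hrest : ‖∑ b ∈ Uᶜ, F b * F (2 * a - b)‖ ≤ ∑ b ∈ Uᶜ, ‖F b‖ ^ 2 := by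
    calc ‖∑ b ∈ Uᶜ, F b * F (2 * a - b)‖
        ≤ ∑ b ∈ Uᶜ, (‖F b‖ ^ 2 + ‖F (2 * a - b)‖ ^ 2) / 2 := by
          refine (norm_sum_le _ _).trans (Finset.sum_le_sum fun b _ => ?_)
          rw [norm_mul]
          nlinarith [sq_nonneg (‖F b‖ - ‖F (2 * a - b)‖)]
      _ = ∑ b ∈ Uᶜ, ‖F b‖ ^ 2 := by
          rw [← Finset.sum_div, Finset.sum_add_distrib, hinv]
          ring
  have hpars : ∑ b ∈ U, ‖F b‖ ^ 2 + ∑ b ∈ Uᶜ, ‖F b‖ ^ 2 = 1 := by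
    rw [Finset.sum_add_sum_compl]
    exact sum_norm_fourierCoeff_sq_of_sign hf
  rw [hsumU fun b => ‖F b‖ ^ 2, hneg, hF0, sq_abs] at hpars
  rw [← Finset.sum_add_sum_compl U, hsumU fun b => F b * F (2 * a - b)] at hconv
  have e1 : F (2 * a - 0) = F (2 * a) := by rw [sub_zero]
  have e2 : F (2 * a - 2 * a) = F 0 := by rw [sub_self]
  have e3 : F (2 * a - a) = F a := by
    congr 1
    ring
  have e4 : F (2 * a - -a) = F (3 * a) := by
    congr 1
    ring
  have e5 : F (2 * a - 3 * a) = F (-a) := by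
    congr 1
    ring
  rw [e1, e2, e3, e4, e5] at hconv
  have hmain : F a ^ 2 = -(2 * F 0 * F (2 * a)) - 2 * F (-a) * F (3 * a)
      - ∑ b ∈ Uᶜ, F b * F (2 * a - b) := by linear_combination hconv
  have hnorm : ‖F a‖ ^ 2 ≤ 2 * |mean f| * ‖F (2 * a)‖ + 2 * ‖F a‖ * ‖F (3 * a)‖
      + ‖∑ b ∈ Uᶜ, F b * F (2 * a - b)‖ := by
    rw [← norm_pow, hmain]
    refine (norm_sub_le _ _).trans (add_le_add_left ?_ _)
    refine (norm_sub_le _ _).trans_eq ?_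
    simp [hneg, hF0]
  nlinarith [sq_nonneg ‖F (2 * a)‖, sq_nonneg ‖F (3 * a)‖]

/-- The Fourier coefficients of a sign function on `ZMod p`, `p ≥ 5`, are at most `√0.47` times
its standard deviation. -/
theorem norm_fourierCoeff_sq_le (hp2 : p ≠ 2) (hp3 : p ≠ 3)
    (hf : ∀ x, f x ^ 2 = 1) {a : ZMod p} (ha : a ≠ 0) :
    ‖fourierCoeff (fun x => (f x : ℂ)) a‖ ^ 2 ≤ 0.47 * (1 - mean f ^ 2) := by
  have h2 := two_ne_zero_of_prime_ne_two hp2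
  have h2a : 2 * a ≠ 0 := mul_ne_zero h2 ha
  have h3a : 3 * a ≠ 0 := mul_ne_zero (three_ne_zero_of_prime_ne_three hp3) ha
  have h4a : 2 * (2 * a) ≠ 0 := mul_ne_zero h2 h2a
  have hconv := norm_fourierCoeff_sq_le_of_convolution hp2 hp3 hf ha
  have hx := norm_fourierCoeff_sq_add_sq_le hp2 hf ha h2a
    (fun h => ha (by linear_combination -h)) (fun h => h3a (by linear_combination h))
  have hy := norm_fourierCoeff_sq_add_sq_le hp2 hf ha h3a
    (fun h => h2a (by linear_combination -h)) (fun h => h4a (by linear_combination h))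
  have htriv := norm_fourierCoeff_le_one_sub_abs_mean hf ha
  have hbias := abs_mean_le_one hf
  rw [← sq_abs (mean f)] at hconv hx hy ⊢
  set C := ‖fourierCoeff (fun x => (f x : ℂ)) a‖
  set x := ‖fourierCoeff (fun x => (f x : ℂ)) (2 * a)‖
  set y := ‖fourierCoeff (fun x => (f x : ℂ)) (3 * a)‖
  set β := |mean f|
  have hC : 0 ≤ C := norm_nonneg _
  have hx0 : 0 ≤ x := norm_nonneg _
  have hy0 : 0 ≤ y := norm_nonneg _
  have hβ : 0 ≤ β := abs_nonneg _
  by_contra! hlt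
  -- The trivial bound forces the bias to be small.
  have hβ1 : β < 1 := by
    rcases hbias.lt_or_eq with h | h
    · exact h
    · rw [h] at htriv hlt
      nlinarith
  have hC2 : C ^ 2 ≤ (1 - β) ^ 2 := pow_le_pow_left₀ hC htriv 2
  have hβ2 : β ≤ 0.361 := by
    by_contra! h
    nlinarith [mul_pos (sub_pos.2 hβ1) (sub_pos.2 h)]
  set V := 1 - β ^ 2 with hV
  have hV0 : 0.869 ≤ V := by nlinarith
  have hx2 : x ^ 2 ≤ 0.03 * V := by linarith
  have hy2 : y ^ 2 ≤ 0.03 * V := by linarith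
  -- `βx` and `Cy` are bounded by multiples of the variance `V`.
  have hβx : β * x ≤ 0.068 * V := by
    refine abs_le_of_sq_le_sq' ?_ (by positivity) |>.2
    nlinarith [mul_le_mul hx2 (pow_le_pow_left₀ hβ hβ2 2) (by positivity) (by positivity)]
  have hCy : C * y ≤ 0.123 * V := by
    refine abs_le_of_sq_le_sq' ?_ (by positivity) |>.2
    have : C ^ 2 ≤ V / 2 := by nlinarith
    nlinarith [mul_le_mul hy2 this (by positivity) (by positivity)]
  nlinarith

end SignFunction

/-! ### Standardised leakage functions -/

section Standardize

variable {p : ℕ} [Fact p.Prime] {f : ZMod p → ℝ}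

/-- A function on `ZMod p` with values `±1`, recentred to have mean zero and rescaled to have
variance one. If the function is constant, the standard deviation is zero and, as division by zero
yields zero, so is the standardisation. -/
noncomputable def standardize (f : ZMod p → ℝ) (x : ZMod p) : ℝ :=
  (f x - mean f) / √(1 - mean f ^ 2)

theorem mean_sq_le_one (hf : ∀ x, f x ^ 2 = 1) : mean f ^ 2 ≤ 1 :=
  (sq_le_one_iff_abs_le_one _).2 (abs_mean_le_one hf)

theorem sum_sub_mean_sq (hf : ∀ x, f x ^ 2 = 1) :
    ∑ x, (f x - mean f) ^ 2 = p * (1 - mean f ^ 2) := by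
  have hp := (prime_cast_pos (p := p)).ne'
  have hsum : ∑ x, f x = p * mean f := by
    rw [mean, mul_inv_cancel_left₀ hp]
  have : ∀ x, (f x - mean f) ^ 2 = 1 + mean f ^ 2 - 2 * mean f * f x := by
    intro x
    linear_combination hf x
  simp_rw [this]
  rw [Finset.sum_sub_distrib, ← Finset.mul_sum, hsum]
  simp [ZMod.card]
  ring

theorem eq_mean_add_standardize (hf : ∀ x, f x ^ 2 = 1) (x : ZMod p) :
    f x = mean f + √(1 - mean f ^ 2) * standardize f x := by
  rcases eq_or_ne (√(1 - mean f ^ 2)) 0 with h | h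
  · have h0 : 1 - mean f ^ 2 = 0 :=
      (Real.sqrt_eq_zero (sub_nonneg.2 (mean_sq_le_one hf))).1 h
    have h1 := sum_sub_mean_sq hf
    rw [h0, mul_zero, Finset.sum_eq_zero_iff_of_nonneg fun _ _ => sq_nonneg _] at h1
    have := pow_eq_zero_iff two_ne_zero |>.1 (h1 x (Finset.mem_univ x))
    rw [h]
    linarith
  · rw [standardize, mul_div_cancel₀ _ h]
    ring

theorem fourierCoeff_standardize_zero :
    fourierCoeff (fun x => (standardize f x : ℂ)) 0 = 0 := by
  have hp := (prime_cast_pos (p := p)).ne'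
  rw [fourierCoeff_zero_ofReal, Complex.ofReal_eq_zero, mean]
  simp only [standardize, ← Finset.sum_div, Finset.sum_sub_distrib]
  simp only [mean, Finset.sum_const, Finset.card_univ, ZMod.card, nsmul_eq_mul]
  rw [mul_inv_cancel_left₀ hp, sub_self, zero_div, mul_zero]

theorem sum_norm_fourierCoeff_standardize_sq_le (hf : ∀ x, f x ^ 2 = 1) :
    ∑ a, ‖fourierCoeff (fun x => (standardize f x : ℂ)) a‖ ^ 2 ≤ 1 := by
  have hp := (prime_cast_pos (p := p)).ne'
  rw [sum_norm_fourierCoeff_sq]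
  simp only [Complex.norm_real, Real.norm_eq_abs, sq_abs, standardize, div_pow]
  rw [← Finset.sum_div, sum_sub_mean_sq hf, Real.sq_sqrt (sub_nonneg.2 (mean_sq_le_one hf)),
    mul_div_assoc, inv_mul_cancel_left₀ hp]
  exact div_self_le_one _

theorem norm_fourierCoeff_standardize_sq_le (hf : ∀ x, f x ^ 2 = 1) {τ : ℝ} (hτ : 0 ≤ τ)
    (h : ∀ a ≠ 0, ‖fourierCoeff (fun x => (f x : ℂ)) a‖ ^ 2 ≤ τ * (1 - mean f ^ 2))
    (a : ZMod p) : ‖fourierCoeff (fun x => (standardize f x : ℂ)) a‖ ^ 2 ≤ τ := by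
  rcases eq_or_ne a 0 with rfl | ha
  · simpa [fourierCoeff_standardize_zero] using hτ
  have hV := sub_nonneg.2 (mean_sq_le_one hf)
  have h1 : (fun x => (standardize f x : ℂ)) =
      fun x => ((√(1 - mean f ^ 2))⁻¹ : ℂ) * ((f x : ℂ) + (-mean f : ℂ)) := by
    funext x
    simp only [standardize]
    push_cast
    ring
  rw [h1, fourierCoeff_const_mul, fourierCoeff_add, fourierCoeff_const _ ha, add_zero, norm_mul,
    mul_pow, norm_inv, Complex.norm_real, Real.norm_eq_abs, inv_pow, sq_abs, Real.sq_sqrt hV]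
  rcases hV.eq_or_lt with h0 | h0
  · simpa [← h0] using hτ
  · rw [inv_mul_le_iff₀ h0, mul_comm]
    exact h a ha

end Standardize

/-! ### Sums of products over sets with information sets -/

section ProductSums

variable {ι K : Type*} [DecidableEq ι] [Fintype K] [DecidableEq K]

theorem sum_prod_le_one_of_injOn (W : Finset (ι → K)) (φ : ι → K → ℝ) (h0 : ∀ i b, 0 ≤ φ i b)
    (h1 : ∀ i, ∑ b, φ i b ≤ 1) (A : Finset ι)
    (hA : Set.InjOn (fun (a : ι → K) (i : A) => a i) W) :
    ∑ a ∈ W, ∏ i ∈ A, φ i (a i) ≤ 1 := by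
  calc ∑ a ∈ W, ∏ i ∈ A, φ i (a i)
      = ∑ b ∈ W.image fun (a : ι → K) (i : A) => a i, ∏ i : A, φ i (b i) := by
        rw [Finset.sum_image hA]
        refine Finset.sum_congr rfl fun a _ => ?_
        exact (Finset.prod_coe_sort A fun i => φ i (a i)).symm
    _ ≤ ∑ b : A → K, ∏ i : A, φ i (b i) :=
        Finset.sum_le_univ_sum_of_nonneg fun b => Finset.prod_nonneg fun i _ => h0 _ _
    _ = ∏ i : A, ∑ b, φ i b := by
        rw [Finset.prod_univ_sum, Fintype.piFinset_univ]
    _ ≤ 1 := Finset.prod_le_one (fun i _ => Finset.sum_nonneg fun b _ => h0 _ _) fun i _ => h1 _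

/-- If both `A` and `B` are sets of coordinates which determine the elements of `W`, then the
factors of these coordinates contribute at most one to the sum of products, by the
arithmetic-geometric mean inequality. -/
theorem sum_prod_le_pow [Fintype ι] (W : Finset (ι → K)) (ψ : ι → K → ℝ) (h0 : ∀ i b, 0 ≤ ψ i b)
    (h1 : ∀ i, ∑ b, ψ i b ^ 2 ≤ 1) {A B R : Finset ι} (hAB : Disjoint A B)
    (hR : Disjoint (A ∪ B) R) {ρ : ℝ} (hρ : ∀ i ∈ R, ∀ b, ψ i b ≤ ρ) (hρ0 : 0 ≤ ρ)
    (hA : Set.InjOn (fun (a : ι → K) (i : A) => a i) W)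
    (hB : Set.InjOn (fun (a : ι → K) (i : B) => a i) W) :
    ∑ a ∈ W, ∏ i, ψ i (a i) ≤ ρ ^ R.card := by
  have hle1 : ∀ i b, ψ i b ≤ 1 := fun i b => by
    have := (Finset.single_le_sum (f := fun b => ψ i b ^ 2) (fun _ _ => by positivity)
      (Finset.mem_univ b)).trans (h1 i)
    exact (sq_le_one_iff₀ (h0 i b)).1 this
  have hterm : ∀ a : ι → K, ∏ i, ψ i (a i) ≤
      (∏ i ∈ A, ψ i (a i) ^ 2 + ∏ i ∈ B, ψ i (a i) ^ 2) / 2 * ρ ^ R.card := by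
    intro a
    rw [← Finset.prod_mul_prod_compl (A ∪ B ∪ R), Finset.prod_union hR, Finset.prod_union hAB,
      Finset.prod_pow, Finset.prod_pow]
    have hA0 : 0 ≤ ∏ i ∈ A, ψ i (a i) := Finset.prod_nonneg fun i _ => h0 _ _
    have hB0 : 0 ≤ ∏ i ∈ B, ψ i (a i) := Finset.prod_nonneg fun i _ => h0 _ _
    have hR0 : 0 ≤ ∏ i ∈ R, ψ i (a i) := Finset.prod_nonneg fun i _ => h0 _ _
    have hR1 : ∏ i ∈ R, ψ i (a i) ≤ ρ ^ R.card := by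
      rw [← Finset.prod_const]
      exact Finset.prod_le_prod (fun i _ => h0 _ _) fun i hi => hρ i hi _
    have hc : ∏ i ∈ (A ∪ B ∪ R)ᶜ, ψ i (a i) ≤ 1 :=
      Finset.prod_le_one (fun i _ => h0 _ _) fun i _ => hle1 _ _
    refine (mul_le_of_le_one_right (by positivity) hc).trans ?_
    refine mul_le_mul ?_ hR1 hR0 (by positivity)
    nlinarith [sq_nonneg (∏ i ∈ A, ψ i (a i) - ∏ i ∈ B, ψ i (a i))]
  refine (Finset.sum_le_sum fun a _ => hterm a).trans ?_
  rw [← Finset.sum_mul, ← Finset.sum_div, Finset.sum_add_distrib]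
  have hA1 := sum_prod_le_one_of_injOn W (fun i b => ψ i b ^ 2) (fun _ _ => by positivity) h1 A hA
  have hB1 := sum_prod_le_one_of_injOn W (fun i b => ψ i b ^ 2) (fun _ _ => by positivity) h1 B hB
  exact mul_le_of_le_one_left (by positivity) (by linarith)

end ProductSums

/-! ### The biased cube -/

section BiasedCube

variable {ι : Type*} [Fintype ι] [DecidableEq ι]

/-- The square root of the probability of the value `u` for a random sign with mean `β`. -/
noncomputable def signAmp (β : ℝ) (u : ℤˣ) : ℝ := √((1 + (u : ℤ) * β) / 2)

theorem signProb_nonneg {β : ℝ} (hβ : |β| ≤ 1) (u : ℤˣ) : 0 ≤ (1 + ((u : ℤ) : ℝ) * β) / 2 := by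
  have := abs_le.1 hβ
  rcases Int.units_eq_one_or u with rfl | rfl <;> simp <;> linarith

theorem signAmp_sq {β : ℝ} (hβ : |β| ≤ 1) (u : ℤˣ) :
    signAmp β u ^ 2 = (1 + (u : ℤ) * β) / 2 :=
  Real.sq_sqrt (signProb_nonneg hβ u)

theorem signAmp_mul_signAmp_neg {β : ℝ} (hβ : |β| ≤ 1) (u : ℤˣ) :
    signAmp β u * signAmp β (-u) = √(1 - β ^ 2) / 2 := by
  rw [signAmp, signAmp, ← Real.sqrt_mul (signProb_nonneg hβ u),
    show √(1 - β ^ 2) / 2 = √((1 - β ^ 2) / 2 ^ 2) by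
      rw [Real.sqrt_div' _ (by positivity), Real.sqrt_sq (by norm_num)]]
  congr 1
  have hu : ((u : ℤ) : ℝ) ^ 2 = 1 := by
    rcases Int.units_eq_one_or u with rfl | rfl <;> simp
  push_cast
  linear_combination (-β ^ 2 / 4) * hu

/-- The functions on `{1, -1} ^ ι`, indexed by the subsets of `ι`, which are obtained from the
characters of the biased cube by multiplication with the square root of the density. They are
orthonormal for the counting measure, also when some of the signs are deterministic. -/
noncomputable def cubeBasis (β : ι → ℝ) (S : Finset ι) (l : ι → ℤˣ) : ℝ :=
  ∏ i, if i ∈ S then ((l i : ℤ) : ℝ) * signAmp (β i) (-l i) else signAmp (β i) (l i)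

theorem sum_cubeBasis_mul {β : ι → ℝ} (hβ : ∀ i, |β i| ≤ 1) (S T : Finset ι) :
    ∑ l, cubeBasis β S l * cubeBasis β T l = if S = T then 1 else 0 := by
  have h1 : ∀ i, signAmp (β i) 1 ^ 2 + signAmp (β i) (-1) ^ 2 = 1 := fun i => by
    rw [signAmp_sq (hβ i), signAmp_sq (hβ i)]
    simp
    ring
  have hcoord : ∀ i, (∑ u : ℤˣ,
      (if i ∈ S then ((u : ℤ) : ℝ) * signAmp (β i) (-u) else signAmp (β i) u) *
        (if i ∈ T then ((u : ℤ) : ℝ) * signAmp (β i) (-u) else signAmp (β i) u)) =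
      if (i ∈ S ↔ i ∈ T) then 1 else 0 := by
    intro i
    rw [UnitsInt.univ, Finset.sum_insert (by decide), Finset.sum_singleton]
    by_cases hS : i ∈ S <;> by_cases hT : i ∈ T <;> simp [hS, hT] <;> linarith [h1 i]
  simp_rw [cubeBasis, ← Finset.prod_mul_distrib]
  rw [← Fintype.prod_sum (fun i (u : ℤˣ) =>
    (if i ∈ S then ((u : ℤ) : ℝ) * signAmp (β i) (-u) else signAmp (β i) u) *
        (if i ∈ T then ((u : ℤ) : ℝ) * signAmp (β i) (-u) else signAmp (β i) u)),
    Finset.prod_congr rfl fun i _ => hcoord i, Finset.prod_ite_zero]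
  simp [Finset.ext_iff]

theorem sum_prod_signAmp_sq {β : ι → ℝ} (hβ : ∀ i, |β i| ≤ 1) :
    ∑ l : ι → ℤˣ, (∏ i, signAmp (β i) (l i)) ^ 2 = 1 := by
  simpa [cubeBasis, sq] using sum_cubeBasis_mul hβ ∅ ∅

/-- The Cauchy-Schwarz inequality with respect to the product measure of the biased signs: an
`L¹` bound for a function on the cube by its Fourier coefficients. -/
theorem sum_abs_sum_le_sqrt {β : ι → ℝ} (hβ : ∀ i, |β i| ≤ 1) (Δ : Finset ι → ℝ) :
    ∑ l : ι → ℤˣ, |∑ S, Δ S * ((∏ i ∈ S, ((l i : ℤ) : ℝ) * √(1 - β i ^ 2) / 2) *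
      ∏ i ∈ Sᶜ, (1 + ((l i : ℤ) : ℝ) * β i) / 2)| ≤ √(∑ S, Δ S ^ 2) := by
  have hfac : ∀ (S : Finset ι) (l : ι → ℤˣ),
      (∏ i ∈ S, ((l i : ℤ) : ℝ) * √(1 - β i ^ 2) / 2) *
        ∏ i ∈ Sᶜ, (1 + ((l i : ℤ) : ℝ) * β i) / 2 =
      (∏ i, signAmp (β i) (l i)) * cubeBasis β S l := by
    intro S l
    rw [cubeBasis, ← Finset.prod_mul_distrib, ← Finset.prod_mul_prod_compl S]
    congr 1
    · refine Finset.prod_congr rfl fun i hi => ?_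
      rw [if_pos hi, mul_div_assoc, ← signAmp_mul_signAmp_neg (hβ i) (l i)]
      ring
    · refine Finset.prod_congr rfl fun i hi => ?_
      rw [if_neg (Finset.mem_compl.1 hi), ← sq, signAmp_sq (hβ i)]
  have hpars : ∑ l : ι → ℤˣ, (∑ S, Δ S * cubeBasis β S l) ^ 2 = ∑ S, Δ S ^ 2 := by
    calc ∑ l : ι → ℤˣ, (∑ S, Δ S * cubeBasis β S l) ^ 2
        = ∑ l : ι → ℤˣ, ∑ S, ∑ T, Δ S * Δ T * (cubeBasis β S l * cubeBasis β T l) := by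
          refine Finset.sum_congr rfl fun l _ => ?_
          rw [sq, Finset.sum_mul_sum]
          refine Finset.sum_congr rfl fun S _ => Finset.sum_congr rfl fun T _ => ?_
          ring
      _ = ∑ S, ∑ T, Δ S * Δ T * ∑ l : ι → ℤˣ, cubeBasis β S l * cubeBasis β T l := by
          rw [Finset.sum_comm]
          refine Finset.sum_congr rfl fun S _ => ?_
          rw [Finset.sum_comm]
          simp_rw [Finset.mul_sum]
      _ = ∑ S, Δ S ^ 2 := by
          simp [sum_cubeBasis_mul hβ, sq]
  have hnonneg : ∀ l : ι → ℤˣ, 0 ≤ ∏ i, signAmp (β i) (l i) :=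
    fun l => Finset.prod_nonneg fun i _ => Real.sqrt_nonneg _
  calc _ = ∑ l : ι → ℤˣ, (∏ i, signAmp (β i) (l i)) * |∑ S, Δ S * cubeBasis β S l| := by
        refine Finset.sum_congr rfl fun l _ => ?_
        rw [← abs_of_nonneg (hnonneg l), ← abs_mul, Finset.mul_sum]
        congr 1
        refine Finset.sum_congr rfl fun S _ => ?_
        rw [hfac]
        ring
    _ ≤ √(∑ l : ι → ℤˣ, (∏ i, signAmp (β i) (l i)) ^ 2) *
          √(∑ l : ι → ℤˣ, |∑ S, Δ S * cubeBasis β S l| ^ 2) :=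
        Real.sum_mul_le_sqrt_mul_sqrt _ _ _
    _ = √(∑ S, Δ S ^ 2) := by
        simp_rw [sq_abs]
        rw [sum_prod_signAmp_sq hβ, hpars, Real.sqrt_one, one_mul]

end BiasedCube

/-! ### Correlations of the shares and the transcript -/

section Leakage

open ZMod

variable {p : ℕ} [Fact p.Prime] {m : ℕ} {C : Submodule (ZMod p) (Fin (m + 1) → ZMod p)}

open Classical in
/-- The sharings of the secret `s`, as a `Finset`. -/
noncomputable def sharingsFinset (C : Submodule (ZMod p) (Fin (m + 1) → ZMod p)) (s : ZMod p) :
    Finset (Fin (m + 1) → ZMod p) :=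
  Finset.univ.filter fun c => c ∈ sharings C s

theorem mem_sharingsFinset {s : ZMod p} {c : Fin (m + 1) → ZMod p} :
    c ∈ sharingsFinset C s ↔ c ∈ C ∧ c 0 = s := by
  classical
  rw [sharingsFinset, Finset.mem_filter]
  exact and_iff_right (Finset.mem_univ c)

theorem IsMDS.sharingsFinset_nonempty (hC : IsMDS C) (hn : 1 ≤ Module.finrank (ZMod p) C)
    (s : ZMod p) : (sharingsFinset C s).Nonempty := by
  obtain ⟨c, hc, h⟩ := hC.exists_mem_eqOn (T := {0}) (by simpa using hn) (fun _ => s)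
  exact ⟨c, mem_sharingsFinset.2 ⟨hc, h 0 (by simp)⟩⟩

/-- The expectation of a function of a random sharing of the secret `s`. -/
noncomputable def shareMean (C : Submodule (ZMod p) (Fin (m + 1) → ZMod p)) (s : ZMod p)
    (h : (Fin (m + 1) → ZMod p) → ℝ) : ℝ :=
  (∑ c ∈ sharingsFinset C s, h c) / (sharingsFinset C s).card

open Classical in
/-- The vectors orthogonal to the shares of the secret zero, that is, the code dual to the code of
these shares. -/
noncomputable def zeroSharesDual (C : Submodule (ZMod p) (Fin (m + 1) → ZMod p)) :
    Finset (Fin m → ZMod p) :=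
  Finset.univ.filter fun a => ∀ z ∈ C, z 0 = 0 → ∑ i, a i * z i.succ = 0

theorem mem_zeroSharesDual {a : Fin m → ZMod p} :
    a ∈ zeroSharesDual C ↔ ∀ z ∈ C, z 0 = 0 → ∑ i, a i * z i.succ = 0 := by
  simp [zeroSharesDual]

/-- A character of the shares averages to zero unless it is trivial on the shares of zero. -/
theorem sum_stdAddChar_eq_zero (s : ZMod p) {a : Fin m → ZMod p} (ha : a ∉ zeroSharesDual C) :
    ∑ c ∈ sharingsFinset C s, (stdAddChar (∑ i, a i * c i.succ) : ℂ) = 0 := by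
  simp only [mem_zeroSharesDual, not_forall] at ha
  obtain ⟨z, hz, hz0, hne⟩ := ha
  have hχ : (stdAddChar (∑ i, a i * z i.succ) : ℂ) ≠ 1 := by
    rw [← AddChar.map_zero_eq_one (stdAddChar (N := p))]
    exact fun h => hne (injective_stdAddChar h)
  have htrans : ∑ c ∈ sharingsFinset C s, (stdAddChar (∑ i, a i * (c + z) i.succ) : ℂ) =
      ∑ c ∈ sharingsFinset C s, (stdAddChar (∑ i, a i * c i.succ) : ℂ) := by
    refine Finset.sum_nbij' (fun c => c + z) (fun c => c - z) ?_ ?_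
      (fun c _ => add_sub_cancel_right _ _) (fun c _ => sub_add_cancel _ _) (fun c _ => rfl)
    · intro c hc
      rw [mem_sharingsFinset] at hc ⊢
      exact ⟨C.add_mem hc.1 hz, by simp [hc.2, hz0]⟩
    · intro c hc
      rw [mem_sharingsFinset] at hc ⊢
      exact ⟨C.sub_mem hc.1 hz, by simp [hc.2, hz0]⟩
  have hmul : ∀ c : Fin (m + 1) → ZMod p, (stdAddChar (∑ i, a i * (c + z) i.succ) : ℂ) =
      stdAddChar (∑ i, a i * c i.succ) * stdAddChar (∑ i, a i * z i.succ) := by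
    intro c
    rw [← AddChar.map_add_eq_mul, ← Finset.sum_add_distrib]
    simp [mul_add]
  simp_rw [hmul] at htrans
  rw [← Finset.sum_mul] at htrans
  by_contra hne0
  exact hχ ((mul_eq_left₀ hne0).1 htrans)

/-- Poisson summation, in the form of an inequality. -/
theorem norm_sum_prod_le (s : ZMod p) (h : Fin m → ZMod p → ℂ) :
    ‖∑ c ∈ sharingsFinset C s, ∏ i, h i (c i.succ)‖ ≤
      (sharingsFinset C s).card *
        ∑ a ∈ zeroSharesDual C, ∏ i, ‖fourierCoeff (h i) (a i)‖ := by
  have hexp : ∀ c : Fin (m + 1) → ZMod p, ∏ i, h i (c i.succ) =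
      ∑ a : Fin m → ZMod p, (∏ i, fourierCoeff (h i) (a i)) *
        stdAddChar (∑ i, a i * c i.succ) := by
    intro c
    calc ∏ i, h i (c i.succ)
        = ∏ i, ∑ b, fourierCoeff (h i) b * stdAddChar (b * c i.succ) :=
          Finset.prod_congr rfl fun i _ => (sum_fourierCoeff_mul _ _).symm
      _ = ∑ a : Fin m → ZMod p, ∏ i, (fourierCoeff (h i) (a i) *
            stdAddChar (a i * c i.succ)) := Fintype.prod_sum _
      _ = _ := by
          refine Finset.sum_congr rfl fun a _ => ?_
          rw [Finset.prod_mul_distrib]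
          congr 1
          exact (map_prod (stdAddChar (N := p)).toMonoidHom
            (fun i => Multiplicative.ofAdd (a i * c i.succ)) Finset.univ).symm
  have hswap : ∑ c ∈ sharingsFinset C s, ∏ i, h i (c i.succ) =
      ∑ a ∈ zeroSharesDual C, (∏ i, fourierCoeff (h i) (a i)) *
        ∑ c ∈ sharingsFinset C s, (stdAddChar (∑ i, a i * c i.succ) : ℂ) := by
    simp_rw [hexp]
    rw [Finset.sum_comm]
    simp_rw [← Finset.mul_sum]
    symm
    refine Finset.sum_subset (Finset.subset_univ _) fun a _ ha => ?_
    rw [sum_stdAddChar_eq_zero s ha, mul_zero]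
  rw [hswap, Finset.mul_sum]
  refine (norm_sum_le _ _).trans (Finset.sum_le_sum fun a _ => ?_)
  rw [norm_mul, norm_prod, mul_comm]
  refine mul_le_mul_of_nonneg_right ?_ (Finset.prod_nonneg fun _ _ => norm_nonneg _)
  refine (norm_sum_le _ _).trans ?_
  simp

/-- The bound on the correlations of the shares of the parties in `S`. Below the dimension of the
code the shares are independent; otherwise the dual code words supported in `S` are determined
by any `#S - n + 1` coordinates, which leaves `2 * n - 2 - #S` coordinates besides two disjoint
sets of that size. -/
theorem IsMDS.abs_shareMean_prod_le (hC : IsMDS C) (s : ZMod p) {g : Fin m → ZMod p → ℝ}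
    {ρ : ℝ} (hρ0 : 0 ≤ ρ)
    (hg0 : ∀ i, fourierCoeff (fun x => (g i x : ℂ)) 0 = 0)
    (hg2 : ∀ i, ∑ a, ‖fourierCoeff (fun x => (g i x : ℂ)) a‖ ^ 2 ≤ 1)
    (hgρ : ∀ i a, ‖fourierCoeff (fun x => (g i x : ℂ)) a‖ ≤ ρ)
    {S : Finset (Fin m)} (hS : S.Nonempty)
    (hSn : S.card + 2 ≤ 2 * Module.finrank (ZMod p) C) :
    |shareMean C s fun c => ∏ i ∈ S, g i (c i.succ)| ≤
      if Module.finrank (ZMod p) C ≤ S.card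
        then ρ ^ (2 * Module.finrank (ZMod p) C - 2 - S.card) else 0 := by
  set n := Module.finrank (ZMod p) C with hn
  set h : Fin m → ZMod p → ℂ := fun i => if i ∈ S then fun x => (g i x : ℂ) else fun _ => 1
    with hh
  have hin : ∀ i ∈ S, h i = fun x => (g i x : ℂ) := fun i hi => by simp [hh, hi]
  have hout : ∀ i ∉ S, h i = fun _ => 1 := fun i hi => by simp [hh, hi]
  have hout0 : ∀ i ∉ S, ∀ b ≠ 0, fourierCoeff (h i) b = 0 := fun i hi b hb => by
    rw [hout i hi, fourierCoeff_const _ hb]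
  have hsq : ∀ i, ∑ b, ‖fourierCoeff (h i) b‖ ^ 2 ≤ 1 := by
    intro i
    by_cases hi : i ∈ S
    · rw [hin i hi]
      exact hg2 i
    · have hp := (prime_cast_pos (p := p)).ne'
      rw [hout i hi, sum_norm_fourierCoeff_sq]
      simp [ZMod.card, hp]
  have hcast : ((∑ c ∈ sharingsFinset C s, ∏ i ∈ S, g i (c i.succ) : ℝ) : ℂ) =
      ∑ c ∈ sharingsFinset C s, ∏ i, h i (c i.succ) := by
    push_cast
    refine Finset.sum_congr rfl fun c _ => ?_
    rw [← Finset.prod_mul_prod_compl S fun i => h i (c i.succ)]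
    have h1 : ∏ i ∈ Sᶜ, h i (c i.succ) = 1 :=
      Finset.prod_eq_one fun i hi => by rw [hout i (Finset.mem_compl.1 hi)]
    rw [h1, mul_one]
    exact Finset.prod_congr rfl fun i hi => by rw [hin i hi]
  have hsum := norm_sum_prod_le (C := C) s h
  rw [← hcast, Complex.norm_real, Real.norm_eq_abs] at hsum
  set W := (zeroSharesDual C).filter fun a => ∀ i ∉ S, a i = 0 with hW
  have hWmem : ∀ a ∈ W, a ∈ zeroSharesDual C ∧ ∀ i ∉ S, a i = 0 := fun a ha =>
    Finset.mem_filter.1 ha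
  have hrestrict : ∑ a ∈ zeroSharesDual C, ∏ i, ‖fourierCoeff (h i) (a i)‖ =
      ∑ a ∈ W, ∏ i, ‖fourierCoeff (h i) (a i)‖ := by
    rw [hW, Finset.sum_filter_of_ne]
    intro a _ hne i hi
    by_contra hai
    exact hne (Finset.prod_eq_zero (Finset.mem_univ i) (by rw [hout0 i hi _ hai, norm_zero]))
  have hbound : ∑ a ∈ W, ∏ i, ‖fourierCoeff (h i) (a i)‖ ≤
      if n ≤ S.card then ρ ^ (2 * n - 2 - S.card) else 0 := by
    split_ifs with hcard
    · obtain ⟨A, hAS, hA⟩ := Finset.exists_subset_card_eq (s := S) (n := S.card - n + 1)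
        (by omega)
      obtain ⟨B, hBS, hB⟩ := Finset.exists_subset_card_eq (s := S \ A) (n := S.card - n + 1)
        (by rw [Finset.card_sdiff_of_subset hAS]; omega)
      have hBS' : B ⊆ S := hBS.trans Finset.sdiff_subset
      have hAB : Disjoint A B := (Finset.disjoint_of_subset_left hBS Finset.sdiff_disjoint).symm
      have hR : (S \ (A ∪ B)).card = 2 * n - 2 - S.card := by
        rw [Finset.card_sdiff_of_subset (Finset.union_subset hAS hBS'),
          Finset.card_union_of_disjoint hAB]
        omega
      have hinj : ∀ D ⊆ S, D.card = S.card - n + 1 →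
          Set.InjOn (fun (a : Fin m → ZMod p) (i : D) => a i) W := by
        intro D hDS hD a ha b hb hab
        obtain ⟨ha1, ha2⟩ := hWmem a ha
        obtain ⟨hb1, hb2⟩ := hWmem b hb
        rw [mem_zeroSharesDual] at ha1 hb1
        refine sub_eq_zero.1 (hC.eq_zero_of_orthogonal (T := S \ D) ?_ ?_ ?_)
        · intro z hz hz0
          simp [sub_mul, ha1 z hz hz0, hb1 z hz hz0]
        · rw [Finset.card_sdiff_of_subset hDS]
          omega
        · intro i hi
          simp only [Finset.mem_sdiff, not_and, not_not] at hi
          rw [Pi.sub_apply, sub_eq_zero]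
          by_cases hiS : i ∈ S
          · exact congrFun hab ⟨i, hi hiS⟩
          · rw [ha2 i hiS, hb2 i hiS]
      rw [← hR]
      refine sum_prod_le_pow W (fun i b => ‖fourierCoeff (h i) b‖) (fun _ _ => norm_nonneg _) hsq
        hAB Finset.disjoint_sdiff ?_ hρ0 (hinj A hAS hA) (hinj B hBS' hB)
      intro i hi b
      rw [hin i (Finset.mem_sdiff.1 hi).1]
      exact hgρ i b
    · refine (Finset.sum_eq_zero fun a ha => ?_).le
      obtain ⟨ha1, ha2⟩ := hWmem a ha
      have ha0 : a = 0 :=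
        hC.eq_zero_of_orthogonal (mem_zeroSharesDual.1 ha1) (by omega : S.card < n) ha2
      obtain ⟨i, hi⟩ := hS
      refine Finset.prod_eq_zero (Finset.mem_univ i) ?_
      rw [ha0, hin i hi, Pi.zero_apply, hg0, norm_zero]
  rw [hrestrict] at hsum
  have hpos : (0 : ℝ) < (sharingsFinset C s).card :=
    Nat.cast_pos.2 (hC.sharingsFinset_nonempty (by omega) s).card_pos
  rw [shareMean, abs_div, abs_of_pos hpos, div_le_iff₀ hpos, mul_comm]
  exact hsum.trans (mul_le_mul_of_nonneg_left hbound hpos.le)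

theorem transcriptProb_eq (f : Fin m → ZMod p → ℤˣ) (s : ZMod p) (l : Fin m → ℤˣ) :
    transcriptProb C f s l =
      shareMean C s fun c => ∏ i, (1 + ((l i : ℤ) : ℝ) * ((f i (c i.succ) : ℤ) : ℝ)) / 2 := by
  classical
  have hind : ∀ c : Fin (m + 1) → ZMod p,
      ∏ i, (1 + ((l i : ℤ) : ℝ) * ((f i (c i.succ) : ℤ) : ℝ)) / 2 =
        if transcript f c = l then (1 : ℝ) else 0 := by
    intro c
    have : ∀ u v : ℤˣ, (1 + ((u : ℤ) : ℝ) * ((v : ℤ) : ℝ)) / 2 = if v = u then 1 else 0 := by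
      intro u v
      rcases Int.units_eq_one_or u with rfl | rfl <;>
        rcases Int.units_eq_one_or v with rfl | rfl <;> norm_num
    simp_rw [this]
    rw [Finset.prod_ite_zero]
    simp [funext_iff, transcript]
  rw [shareMean, transcriptProb, Finset.sum_congr rfl fun c _ => hind c, Finset.sum_boole]
  have h1 : sharings C s = (sharingsFinset C s : Set (Fin (m + 1) → ZMod p)) := by
    ext c
    rw [Finset.mem_coe, mem_sharingsFinset]
    rfl
  have h2 : {c ∈ sharings C s | transcript f c = l} =
      ((sharingsFinset C s).filter fun c => transcript f c = l :
        Set (Fin (m + 1) → ZMod p)) := by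
    rw [h1]
    ext c
    simp
  rw [h2, h1, Set.ncard_coe_finset, Set.ncard_coe_finset]

/-- The distribution of the transcript, expanded in the standardised leakage functions. -/
theorem transcriptProb_eq_sum (f : Fin m → ZMod p → ℤˣ) (s : ZMod p) (l : Fin m → ℤˣ) :
    transcriptProb C f s l =
      ∑ S : Finset (Fin m),
        (shareMean C s fun c => ∏ i ∈ S, standardize (fun x => ((f i x : ℤ) : ℝ)) (c i.succ)) *
        ((∏ i ∈ S, ((l i : ℤ) : ℝ) * √(1 - mean (fun x => ((f i x : ℤ) : ℝ)) ^ 2) / 2) *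
          ∏ i ∈ Sᶜ, (1 + ((l i : ℤ) : ℝ) * mean (fun x => ((f i x : ℤ) : ℝ))) / 2) := by
  have hsq : ∀ i x, ((f i x : ℤ) : ℝ) ^ 2 = 1 := fun i x => by
    rcases Int.units_eq_one_or (f i x) with h | h <;> simp [h]
  have hexp : ∀ c : Fin (m + 1) → ZMod p,
      ∏ i, (1 + ((l i : ℤ) : ℝ) * ((f i (c i.succ) : ℤ) : ℝ)) / 2 =
      ∑ S : Finset (Fin m), (∏ i ∈ S, standardize (fun x => ((f i x : ℤ) : ℝ)) (c i.succ)) *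
        ((∏ i ∈ S, ((l i : ℤ) : ℝ) * √(1 - mean (fun x => ((f i x : ℤ) : ℝ)) ^ 2) / 2) *
          ∏ i ∈ Sᶜ, (1 + ((l i : ℤ) : ℝ) * mean (fun x => ((f i x : ℤ) : ℝ))) / 2) := by
    intro c
    have : ∀ i, (1 + ((l i : ℤ) : ℝ) * ((f i (c i.succ) : ℤ) : ℝ)) / 2 =
        standardize (fun x => ((f i x : ℤ) : ℝ)) (c i.succ) *
          (((l i : ℤ) : ℝ) * √(1 - mean (fun x => ((f i x : ℤ) : ℝ)) ^ 2) / 2) +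
        (1 + ((l i : ℤ) : ℝ) * mean (fun x => ((f i x : ℤ) : ℝ))) / 2 := by
      intro i
      have := eq_mean_add_standardize (f := fun x => ((f i x : ℤ) : ℝ)) (hsq i) (c i.succ)
      linear_combination (((l i : ℤ) : ℝ) / 2) * this
    simp_rw [this]
    rw [Fintype.prod_add]
    refine Finset.sum_congr rfl fun S _ => ?_
    rw [Finset.prod_mul_distrib, mul_assoc]
  rw [transcriptProb_eq]
  simp only [shareMean]
  simp_rw [hexp]
  rw [Finset.sum_comm, Finset.sum_div]
  refine Finset.sum_congr rfl fun S _ => ?_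
  rw [← Finset.sum_mul]
  ring

/-- The total variation distance of two transcripts, if all Fourier coefficients of the leakage
functions at non-zero frequencies are at most `√τ` times their standard deviations. -/
theorem IsMDS.tvDist_sq_le (hC : IsMDS C) {τ : ℝ} (hτ0 : 0 < τ) (hτ3 : 1 ≤ 3 * τ)
    (hm : m + 2 ≤ 2 * Module.finrank (ZMod p) C) (hn2 : 2 ≤ Module.finrank (ZMod p) C)
    (f : Fin m → ZMod p → ℤˣ)
    (hf : ∀ i, ∀ a ≠ 0, ‖fourierCoeff (fun x => (((f i x : ℤ) : ℝ) : ℂ)) a‖ ^ 2 ≤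
      τ * (1 - mean (fun x => ((f i x : ℤ) : ℝ)) ^ 2)) (s s' : ZMod p) :
    tvDist (transcriptProb C f s) (transcriptProb C f s') ^ 2 ≤
      (τ⁻¹) ^ 2 * (τ / 3) ^ Module.finrank (ZMod p) C * 4 ^ m := by
  set n := Module.finrank (ZMod p) C with hn
  have hsq : ∀ i x, ((f i x : ℤ) : ℝ) ^ 2 = 1 := fun i x => by
    rcases Int.units_eq_one_or (f i x) with h | h <;> simp [h]
  set g : Fin m → ZMod p → ℝ := fun i => standardize fun x => ((f i x : ℤ) : ℝ) with hg
  set Δ : Finset (Fin m) → ℝ := fun S => (shareMean C s fun c => ∏ i ∈ S, g i (c i.succ)) -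
    shareMean C s' fun c => ∏ i ∈ S, g i (c i.succ) with hΔ
  have hone : ∀ t, (shareMean C t fun _ => 1) = 1 := by
    intro t
    have := (hC.sharingsFinset_nonempty (by omega) t).card_pos.ne'
    simp [shareMean, this]
  have hmoment : ∀ t, ∀ S : Finset (Fin m), S.Nonempty →
      |shareMean C t fun c => ∏ i ∈ S, g i (c i.succ)| ≤
        if n ≤ S.card then √τ ^ (2 * n - 2 - S.card) else 0 := by
    intro t S hS
    refine hC.abs_shareMean_prod_le t (Real.sqrt_nonneg τ)
      (fun i => fourierCoeff_standardize_zero)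
      (fun i => sum_norm_fourierCoeff_standardize_sq_le (hsq i)) (fun i a => ?_) hS ?_
    · exact Real.le_sqrt_of_sq_le
        (norm_fourierCoeff_standardize_sq_le (hsq i) hτ0.le (hf i) a)
    · have := Finset.card_le_univ S
      rw [Fintype.card_fin] at this
      omega
  have hΔ2 : ∀ S, Δ S ^ 2 ≤ 4 * (τ ^ (n - 2) * (3⁻¹) ^ n * 3 ^ S.card) := by
    intro S
    have hnonneg : 0 ≤ 4 * (τ ^ (n - 2) * (3⁻¹ : ℝ) ^ n * 3 ^ S.card) := by positivity
    rcases S.eq_empty_or_nonempty with rfl | hS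
    · simpa [hΔ, hone] using hnonneg
    · have h1 := hmoment s S hS
      have h2 := hmoment s' S hS
      split_ifs at h1 h2 with hcard
      · have h3 : |Δ S| ≤ 2 * √τ ^ (2 * n - 2 - S.card) :=
          (abs_sub _ _).trans (by linarith)
        have hSm := Finset.card_le_univ S
        rw [Fintype.card_fin] at hSm
        obtain ⟨d, hd⟩ := Nat.exists_eq_add_of_le hcard
        obtain ⟨e, he⟩ : ∃ e, n - 2 = d + e := ⟨n - 2 - d, by omega⟩
        have hexp : 2 * n - 2 - S.card = e := by omega
        rw [hexp] at h3
        calc Δ S ^ 2 = |Δ S| ^ 2 := (sq_abs _).symm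
          _ ≤ (2 * √τ ^ e) ^ 2 := pow_le_pow_left₀ (abs_nonneg _) h3 2
          _ = 4 * τ ^ e := by
              rw [mul_pow, ← pow_mul, mul_comm e, pow_mul, Real.sq_sqrt hτ0.le]
              norm_num
          _ ≤ 4 * (τ ^ e * (3 * τ) ^ d) := by
              gcongr
              exact le_mul_of_one_le_right (by positivity) (one_le_pow₀ hτ3)
          _ = 4 * (τ ^ (n - 2) * (3⁻¹) ^ n * 3 ^ S.card) := by
              rw [he, hd, pow_add 3, pow_add τ, mul_pow]
              have : (3⁻¹ : ℝ) ^ n * 3 ^ n = 1 := by rw [← mul_pow]; norm_num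
              linear_combination (-4 * τ ^ d * τ ^ e * 3 ^ d) * this
      · have h3 : Δ S = 0 := by
          simp only [hΔ]
          rw [abs_nonpos_iff.1 h1, abs_nonpos_iff.1 h2, sub_zero]
        simpa [h3] using hnonneg
  have hsum3 : ∑ S : Finset (Fin m), (3 : ℝ) ^ S.card = 4 ^ m := by
    have := Fintype.prod_add (fun _ : Fin m => (3 : ℝ)) (fun _ => 1)
    simp only [Finset.prod_const, one_pow, mul_one, Finset.card_univ, Fintype.card_fin] at this
    rw [← this]
    norm_num
  have htv : tvDist (transcriptProb C f s) (transcriptProb C f s') ≤ 1 / 2 * √(∑ S, Δ S ^ 2) := by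
    rw [tvDist]
    refine mul_le_mul_of_nonneg_left ?_ (by norm_num)
    refine le_of_eq_of_le (Finset.sum_congr rfl fun l _ => ?_)
      (sum_abs_sum_le_sqrt (β := fun i => mean fun x => ((f i x : ℤ) : ℝ))
        (fun i => abs_mean_le_one (hsq i)) Δ)
    rw [transcriptProb_eq_sum, transcriptProb_eq_sum, ← Finset.sum_sub_distrib]
    simp only [hΔ, hg, sub_mul]
  have htv0 : 0 ≤ tvDist (transcriptProb C f s) (transcriptProb C f s') := by
    rw [tvDist]
    positivity
  have hτn : τ ^ (n - 2) = (τ⁻¹) ^ 2 * τ ^ n := by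
    obtain ⟨k, hk⟩ := Nat.exists_eq_add_of_le hn2
    rw [hk, Nat.add_sub_cancel_left, pow_add]
    field_simp
  calc tvDist (transcriptProb C f s) (transcriptProb C f s') ^ 2
      ≤ (1 / 2 * √(∑ S, Δ S ^ 2)) ^ 2 := pow_le_pow_left₀ htv0 htv 2
    _ = 1 / 4 * ∑ S, Δ S ^ 2 := by
        rw [mul_pow, Real.sq_sqrt (Finset.sum_nonneg fun _ _ => sq_nonneg _)]
        norm_num
    _ ≤ 1 / 4 * ∑ S : Finset (Fin m), 4 * (τ ^ (n - 2) * (3⁻¹) ^ n * 3 ^ S.card) := by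
        gcongr with S
        exact hΔ2 S
    _ = (τ⁻¹) ^ 2 * (τ / 3) ^ n * 4 ^ m := by
        rw [← Finset.mul_sum, ← Finset.mul_sum, hsum3, hτn, div_eq_mul_inv τ, mul_pow]
        ring

end Leakage

/-! ### The exponent -/

section Exponent

/-- `τ = 0.47` gives exponential decay at rate `0.7496`, as `(0.47 / 3) ^ 61 ≤ 2 ^ (-163)` and
`0.7496 * 163 / 61 > 2.003`. -/
theorem pow_mul_four_pow_le {n m : ℕ} (hnm : (0.7496 : ℝ) * m ≤ n) :
    (0.47 / 3 : ℝ) ^ n * 4 ^ m ≤ (2 : ℝ) ^ (-(0.003 * (m : ℝ))) := by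
  have h61 : ((0.47 / 3 : ℝ) ^ n) ^ 61 ≤ ((2 : ℝ) ^ (-(163 / 61 * (n : ℝ)))) ^ 61 := by
    calc ((0.47 / 3 : ℝ) ^ n) ^ 61 = ((0.47 / 3 : ℝ) ^ 61) ^ n := by
          rw [← pow_mul, ← pow_mul, mul_comm]
      _ ≤ ((2 : ℝ)⁻¹ ^ 163) ^ n := by
          gcongr
          norm_num
      _ = ((2 : ℝ) ^ (-(163 / 61 * (n : ℝ)))) ^ 61 := by
          rw [← Real.rpow_mul_natCast (by norm_num), inv_pow, ← Real.rpow_natCast 2 163,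
            ← Real.rpow_neg (by norm_num), ← Real.rpow_mul_natCast (by norm_num)]
          congr 1
          push_cast
          ring
  have h1 : (0.47 / 3 : ℝ) ^ n ≤ (2 : ℝ) ^ (-(163 / 61 * (n : ℝ))) :=
    le_of_pow_le_pow_left₀ (by norm_num) (by positivity) h61
  have h4 : (4 : ℝ) ^ m = (2 : ℝ) ^ (2 * (m : ℝ)) := by
    rw [Real.rpow_mul (by norm_num), Real.rpow_natCast]
    norm_num
  calc (0.47 / 3 : ℝ) ^ n * 4 ^ m ≤ (2 : ℝ) ^ (-(163 / 61 * (n : ℝ))) * (2 : ℝ) ^ (2 * (m : ℝ)) := by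
        rw [h4]
        gcongr
    _ = (2 : ℝ) ^ (-(163 / 61 * (n : ℝ)) + 2 * (m : ℝ)) := (Real.rpow_add (by norm_num) _ _).symm
    _ ≤ (2 : ℝ) ^ (-(0.003 * (m : ℝ))) := by
        refine Real.rpow_le_rpow_of_exponent_le (by norm_num) ?_
        linarith [(Nat.cast_nonneg m : (0 : ℝ) ≤ m)]

end Exponent

end LeakageResilience


theorem proposition1p8 :
    ∃ c : ℝ, 0 < c ∧ ∃ m₀ : ℕ, ∀ m : ℕ, m₀ ≤ m →
      ∀ (p : ℕ) [Fact p.Prime], p ≠ 2 →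
        ∀ C : Submodule (ZMod p) (Fin (m + 1) → ZMod p),
          LeakageResilience.IsMDS C →
          (0.7496 : ℝ) ≤ (Module.finrank (ZMod p) C : ℝ) / (m : ℝ) →
          LeakageResilience.OneBitLeakageResilient C ((2 : ℝ) ^ (-(c * (m : ℝ)))) := by
  open LeakageResilience in
  refine ⟨0.001, by norm_num, 5000, fun m hm p _ hp2 C hC hrate f s s' _ => ?_⟩
  have hm' : (5000 : ℝ) ≤ m := by exact_mod_cast hm
  rw [le_div_iff₀ (by linarith)] at hrate
  set n := Module.finrank (ZMod p) C with hn
  have hmn : m + 2 ≤ 2 * n := by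
    have : (m : ℝ) + 2 ≤ 2 * n := by linarith
    exact_mod_cast this
  have hsq : ∀ i x, ((f i x : ℤ) : ℝ) ^ 2 = 1 := fun i x => by
    rcases Int.units_eq_one_or (f i x) with h | h <;> simp [h]
  -- The constant factor is absorbed by one third of the exponent.
  suffices h : tvDist (transcriptProb C f s) (transcriptProb C f s') ^ 2 ≤
      32 * (2 : ℝ) ^ (-(0.003 * (m : ℝ))) by
    refine le_of_sq_le_sq (h.trans ?_) (by positivity)
    rw [← Real.rpow_mul_natCast (by norm_num), show (32 : ℝ) = (2 : ℝ) ^ (5 : ℝ) by norm_num,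
      ← Real.rpow_add (by norm_num)]
    refine Real.rpow_le_rpow_of_exponent_le (by norm_num) ?_
    push_cast
    linarith
  rcases eq_or_ne p 3 with rfl | hp3
  · -- Over the field with three elements there are no long MDS codes of codimension above two.
    have hlen := hC.length_succ_le (by omega)
    rw [ZMod.card] at hlen
    have hbound := hC.tvDist_sq_le (τ := 1 / 2) (by norm_num) (by norm_num) hmn (by omega) f
      (fun i a ha => by
        have := two_mul_norm_fourierCoeff_sq_le hp2 (hsq i) ha
        linarith) s s'
    refine hbound.trans ?_
    obtain ⟨k, rfl⟩ : ∃ k, m = k + 1 := ⟨m - 1, by omega⟩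
    have h6 : (1 / 2 / 3 : ℝ) ^ n ≤ (1 / 6) ^ k := by
      rw [show (1 / 2 / 3 : ℝ) = 1 / 6 by norm_num]
      exact pow_le_pow_of_le_one (by norm_num) (by norm_num) (by omega)
    have h23 : (2 / 3 : ℝ) ≤ (2 : ℝ) ^ (-(1 / 2) : ℝ) := by
      refine le_of_sq_le_sq ?_ (by positivity)
      rw [← Real.rpow_mul_natCast (by norm_num)]
      norm_num [Real.rpow_neg]
    calc ((1 / 2 : ℝ)⁻¹) ^ 2 * (1 / 2 / 3) ^ n * 4 ^ (k + 1)
        ≤ ((1 / 2 : ℝ)⁻¹) ^ 2 * (1 / 6) ^ k * 4 ^ (k + 1) := by gcongr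
      _ = 16 * (2 / 3) ^ k := by
          rw [show (2 / 3 : ℝ) = 1 / 6 * 4 by norm_num, mul_pow]
          ring
      _ ≤ 16 * ((2 : ℝ) ^ (-(1 / 2) : ℝ)) ^ k := by gcongr
      _ ≤ 32 * (2 : ℝ) ^ (-(0.003 * ((k + 1 : ℕ) : ℝ))) := by
          rw [← Real.rpow_mul_natCast (by norm_num)]
          refine mul_le_mul (by norm_num) ?_ (by positivity) (by norm_num)
          refine Real.rpow_le_rpow_of_exponent_le (by norm_num) ?_
          push_cast at hm' ⊢
          linarith
  · have hbound := hC.tvDist_sq_le (τ := 0.47) (by norm_num) (by norm_num) hmn (by omega) f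
      (fun i a ha => norm_fourierCoeff_sq_le hp2 hp3 (hsq i) ha) s s'
    refine hbound.trans ?_
    rw [mul_assoc]
    exact mul_le_mul (by norm_num) (pow_mul_four_pow_le hrate) (by positivity) (by norm_num)
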